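/- **The game.** (Baccara banque, simplified model, cards dealt with replacement.) A card has value $0$ with probability $4/13$ and each value $1,\dots,9$ with probability $1/13$; the total of a hand is the sum of its card values modulo $10$, so a two-card hand has total $0$ with probability $25/169$ and each total $1,\dots,9$ with probability $16/169$. Player 1, Player 2 and Banker independently receive two-card hands; a total of $8$ or $9$ is a natural. If Banker has a natural, play ends and the totals are compared; if Banker has no natural, a Player with a natural wins his bet, and play continues for a Player without one. Such a Player draws a third card on totals $0$–$4$, stands on $6$–$7$, and on $5$ either stands (pure strategy $0$) or draws (pure strategy $1$). Unless both Players have naturals, Banker (without a natural) then sees $(k_1,k_2)$, where $k_i$ is Player $i$'s third-card value, or $10$ if Player $i$ stands, or $11$ if Player $i$ has a natural, and, knowing his own two-card total $j\in\{0,\dots,7\}$, draws a third card or stands. A pure strategy of Banker is the set $T$ of those of the $(12\cdot12-1)\cdot 8=1144$ triples $(k_1,k_2,j)$ at which he draws. The higher final total wins at even odds, and ties are a push. A proportion $\theta$ of the total bet is on Player 1's hand and $1-\theta$ on Player 2's. Let $a_{u_1,u_2,T}(\theta)$ be the expected total gain of the two Players, in units of the total bet, under pure strategies $u_1,u_2\in\{0,1\}$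 and $T$. In the independent cooperative game the Players form a coalition against Banker, but draw on $5$ independently with probabilities $p_1,p_2\in[0,1]$; Banker uses a mixed strategy $q$ (a probability vector over all $T$). The payoff to the Players is $$\Pi_\theta(p_1,p_2;q)=\sum_T q_T\big[(1-p_1)(1-p_2)a_{0,0,T}(\theta)+(1-p_1)p_2\,a_{0,1,T}(\theta)+p_1(1-p_2)a_{1,0,T}(\theta)+p_1p_2\,a_{1,1,T}(\theta)\big].$$ The lower and upper values are $\underline v=\max_{p_1,p_2}\min_q\Pi_\theta$ and $\overline v=\min_q\max_{p_1,p_2}\Pi_\theta$; a maximin strategy is a pair $(p_1,p_2)$ attaining the maximum in $\underline v$; the game has a value if $\underline v=\overline v$. **Theorem.** Let $\theta=1/2$. 1. There is exactly one maximin strategy of the Players, namely $$p_1=p_2=\frac{-319+\sqrt{245569}}{224}\approx 0.788166 .$$ 2. The lower value is $$\underline v=\frac{5\,(-1933207795+260493\sqrt{245569})}{98\cdot 13^9}\approx -0.00867999 .$$ 3. Banker's pure best responses $T$ to this $(p_1,p_2)$ are exactly those $T$ which, for each triple $(k_1,k_2,j)$ other than $(6,10,6)$ and $(10,6,6)$,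 contain $(k_1,k_2,j)$ if and only if $j\le m(k_1,k_2)$, where the maximum drawing totals $m(k_1,k_2)$ are (rows $k_1=0,\dots,11$, columns $k_2=0,\dots,11$) $$\begin{array}{cccccccccccc} 3&3&3&4&4&4&4&3&3&3&5&3\\ 3&3&4&4&4&4&4&4&3&3&5&3\\ 3&4&4&4&4&4&5&4&3&3&5&4\\ 4&4&4&4&4&5&5&4&4&3&5&4\\ 4&4&4&4&5&5&5&5&4&4&5&5\\ 4&4&4&5&5&5&5&5&5&4&5&5\\ 4&4&5&5&5&5&6&6&5&4&5&6\\ 3&4&4&4&5&5&6&6&3&3&6&6\\ 3&3&3&4&4&5&5&3&2&3&5&2\\ 3&3&3&3&4&4&4&3&3&3&5&3\\ 5&5&5&5&5&5&5&6&5&5&5&5\\ 3&3&4&4&5&5&6&6&2&3&5&- \end{array}$$ In particular, Banker is indifferent at $(6,10,6)$ and $(10,6,6)$. 4. $\underline v<\overline v$; hence the independent cooperative game has no value. The approximations are correct to the displayed number of digits (error less than half a unit in the last digit). -/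

import Mathlib

namespace BaccaraBanque

noncomputable section

/-- Probability that a two-card hand has total `i` (cards dealt with replacement). -/
def totalProb (i : ℕ) : ℝ := (16 + if i = 0 then 9 else 0) / 13 ^ 2

/-- Probability that a single card has value `k`. -/
def cardProb (k : ℕ) : ℝ := (1 + if k = 0 then 3 else 0) / 13

/-- Sign of `a - b` for final totals `a` (Player) and `b` (Banker), in `{-1, 0, 1}`. -/
def compareTotals (a b : ℕ) : ℝ := (Int.sign ((a : ℤ) - (b : ℤ)) : ℝ)

/-- What Banker sees of a Player who uses pure strategy `u` (`0`: stand on 5, `1`: draw on 5), has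
two-card total `i`, and would draw a third card of value `k`: the code is `11` for a natural, `10`
for "stands", and the value `k` of the third card if the Player draws. -/
def signal (u i k : ℕ) : ℕ := if 8 ≤ i then 11 else if i ≤ 4 + u then k else 10

/-- Final total of such a Player (in a round that does not end at once). -/
def playerTotal (u i k : ℕ) : ℕ := if i ≤ 4 + u then (i + k) % 10 else i

/-- Banker's information sets `(k₁, k₂, j)`: the two signals, not both naturals, and Banker's
two-card total `j ≤ 7`. There are `(12 * 12 - 1) * 8 = 1144` of them. -/
def infoSets : Finset (ℕ × ℕ × ℕ) :=
  (Finset.range 12 ×ˢ Finset.range 12 ×ˢ Finset.range 8).filter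
    (fun s => ¬ (s.1 = 11 ∧ s.2.1 = 11))

/-- A pure strategy of Banker: the set of information sets on which he draws. -/
abbrev BankerStrategy : Type := {T : Finset (ℕ × ℕ × ℕ) // T ∈ infoSets.powerset}

/-- Banker's final total, when his two-card total is `j ≤ 7`, the signals are `s₁, s₂`, and his
third card would have value `l`. -/
def bankerTotal (T : BankerStrategy) (s₁ s₂ j l : ℕ) : ℕ :=
  if (s₁, s₂, j) ∈ T.1 then (j + l) % 10 else j

/-- Gain, per unit bet on his hand, of a Player with pure strategy `u`, two-card total `i` and
potential third card `k`, when Banker's two-card total is `j` and his final total in case of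
continued play is `b`. If Banker has a natural, play ends and the two-card totals are compared; if
Banker has no natural and the Player has one, the Player wins; otherwise final totals are
compared. -/
def playerGain (u i k j b : ℕ) : ℝ :=
  if 8 ≤ j then compareTotals i j
  else if 8 ≤ i then 1
  else compareTotals (playerTotal u i k) b

/-- Payoff matrix `a_{u₁,u₂,T}(θ)`: the expected total gain of the two Players, in units of the
total amount bet, when the proportion `θ` is bet on Player 1's hand and `1 - θ` on Player 2's.
The sum runs over the two-card totals `i₁, i₂, j` of Player 1, Player 2 and Banker, and over the
values `k₁, k₂, l` of the third cards that they receive if they draw. -/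
def payoff (θ : ℝ) (u₁ u₂ : ℕ) (T : BankerStrategy) : ℝ :=
  ∑ i₁ ∈ Finset.range 10, ∑ i₂ ∈ Finset.range 10, ∑ j ∈ Finset.range 10,
  ∑ k₁ ∈ Finset.range 10, ∑ k₂ ∈ Finset.range 10, ∑ l ∈ Finset.range 10,
    totalProb i₁ * totalProb i₂ * totalProb j * cardProb k₁ * cardProb k₂ * cardProb l *
      (θ * playerGain u₁ i₁ k₁ j (bankerTotal T (signal u₁ i₁ k₁) (signal u₂ i₂ k₂) j l)
        + (1 - θ) *
          playerGain u₂ i₂ k₂ j (bankerTotal T (signal u₁ i₁ k₁) (signal u₂ i₂ k₂) j l))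

/-- The Players' expected total gain when they independently draw on 5 with probabilities
`p.1` and `p.2`, and Banker uses the pure strategy `T`. -/
def indepPayoff (θ : ℝ) (p : ℝ × ℝ) (T : BankerStrategy) : ℝ :=
  (1 - p.1) * (1 - p.2) * payoff θ 0 0 T + (1 - p.1) * p.2 * payoff θ 0 1 T
    + p.1 * (1 - p.2) * payoff θ 1 0 T + p.1 * p.2 * payoff θ 1 1 T

/-- Pairs `(p₁, p₂)` of probabilities: the independent strategies of the Players. -/
def indepStrategies : Set (ℝ × ℝ) := Set.Icc 0 1 ×ˢ Set.Icc 0 1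

/-- Mixed strategies of Banker: probability vectors indexed by his pure strategies. -/
def bankerMixed : Set (BankerStrategy → ℝ) := stdSimplex ℝ BankerStrategy

/-- The Players' expected total gain against a mixed strategy `q` of Banker. -/
def mixedPayoff (θ : ℝ) (p : ℝ × ℝ) (q : BankerStrategy → ℝ) : ℝ :=
  ∑ T : BankerStrategy, q T * indepPayoff θ p T

/-- The gain which the independent strategy `p` guarantees to the Players. -/
def guarantee (θ : ℝ) (p : ℝ × ℝ) : ℝ := ⨅ q : bankerMixed, mixedPayoff θ p q

/-- Lower value of the independent cooperative game. -/
def lowerValue (θ : ℝ) : ℝ :=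
  ⨆ p : indepStrategies, ⨅ q : bankerMixed, mixedPayoff θ p q

/-- Upper value of the independent cooperative game. -/
def upperValue (θ : ℝ) : ℝ :=
  ⨅ q : bankerMixed, ⨆ p : indepStrategies, mixedPayoff θ p q

/-- The independent cooperative game has a value. -/
def HasValue (θ : ℝ) : Prop := lowerValue θ = upperValue θ

/-- `p` is a maximin strategy of the independent Players. -/
def IsMaximin (θ : ℝ) (p : ℝ × ℝ) : Prop :=
  p ∈ indepStrategies ∧ IsMaxOn (guarantee θ) indepStrategies p

/-- `T` is a (pure) best response of Banker to `p`. -/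
def IsBestResponse (θ : ℝ) (p : ℝ × ℝ) (T : BankerStrategy) : Prop :=
  ∀ T' : BankerStrategy, indepPayoff θ p T ≤ indepPayoff θ p T'

/-- Banker's maximum drawing totals: row `k₁`, column `k₂`. The last entry of the last row is a
placeholder, as `(11, 11)` does not occur; at `(6, 10)` and `(10, 6)` the entry concerns only the
totals other than 6. -/
def bankerTable : List (List ℕ) :=
  [[3, 3, 3, 4, 4, 4, 4, 3, 3, 3, 5, 3],
   [3, 3, 4, 4, 4, 4, 4, 4, 3, 3, 5, 3],
   [3, 4, 4, 4, 4, 4, 5, 4, 3, 3, 5, 4],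
   [4, 4, 4, 4, 4, 5, 5, 4, 4, 3, 5, 4],
   [4, 4, 4, 4, 5, 5, 5, 5, 4, 4, 5, 5],
   [4, 4, 4, 5, 5, 5, 5, 5, 5, 4, 5, 5],
   [4, 4, 5, 5, 5, 5, 6, 6, 5, 4, 5, 6],
   [3, 4, 4, 4, 5, 5, 6, 6, 3, 3, 6, 6],
   [3, 3, 3, 4, 4, 5, 5, 3, 2, 3, 5, 2],
   [3, 3, 3, 3, 4, 4, 4, 3, 3, 3, 5, 3],
   [5, 5, 5, 5, 5, 5, 5, 6, 5, 5, 5, 5],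
   [3, 3, 4, 4, 5, 5, 6, 6, 2, 3, 5, 0]]

/-- Entry of the table for the signals `k₁, k₂`. -/
def maxDrawingTotal (k₁ k₂ : ℕ) : ℕ := (bankerTable.getD k₁ []).getD k₂ 0

end

end BaccaraBanque

namespace BaccaraBanque

/-! Multiplied by `2 * 13 ^ 9`, the payoff at `θ = 1/2` is a sum of integer cells, one for each pair
of signals and each Banker total. Given Banker's total and the two signals, the Players' hands are
independent, so a cell is a product of one-Player quantities, few enough to tabulate and verify by
kernel evaluation. Banker's choices at different triples do not interact, so he minimizes cell by
cell.

Let `r` be the positive root of `112 r² + 319 r = 321`. Against `(r, r)` the effect of drawing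
vanishes at `(6, 10, 6)` and `(10, 6, 6)` and has a strict sign at every other triple. This gives
the best responses (`mixedCell_drawProb_sign`, `isBestResponse_drawProb_iff`).

Four best responses, given by the free choices at these two triples, yield the same payoff at `(r,
r)`. For each other `(x, y)` one of them, chosen by the signs of `x - r` and `y - r`, gives the
Players strictly less (`exists_tableForm_lt`). Hence `(r, r)` is the unique maximin strategy.

For the upper value, let the Players correlate, with weights 1/5, 1/5, 3/5 on the vertices `(0, 1)`,
`(1, 0)`, `(1, 1)`. Against every `T` this yields more than the lower value (`correlated_guarantee`,
`scaledValue_lt`). Against any mixed strategy of Banker, the best vertex does at least as well as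
this average, so the upper value is strictly larger. -/

/-! ### Reduction of the payoff to integer cells -/

/-- `169` times the probability of the two-card total `i`. -/
def totalWeight (i : ℕ) : ℤ := 16 + if i = 0 then 9 else 0

/-- `13` times the probability of the card value `k`. -/
def cardWeight (k : ℕ) : ℤ := 1 + if k = 0 then 3 else 0

/-- Integer-valued form of `playerGain`. -/
def integerGain (u i k j b : ℕ) : ℤ :=
  if 8 ≤ j then Int.sign ((i : ℤ) - (j : ℤ))
  else if 8 ≤ i then 1
  else Int.sign ((playerTotal u i k : ℤ) - (b : ℤ))

/-- Banker's final total, when `m` says whether he draws. -/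
def finalTotal (m : Bool) (j l : ℕ) : ℕ := if m then (j + l) % 10 else j

/-- Weight `13 ^ 3 * P` of the signal `s` of a Player with pure strategy `u`. -/
def signalWeight (u s : ℕ) : ℤ :=
  ∑ i ∈ Finset.range 10, ∑ k ∈ Finset.range 10,
    if signal u i k = s then totalWeight i * cardWeight k else 0

/-- Weighted gain of a Player with pure strategy `u` on the event that his signal is `s`, when
Banker's two-card total is `j` and `m` says whether Banker draws. -/
def signalGain (u s j : ℕ) (m : Bool) : ℤ :=
  ∑ i ∈ Finset.range 10, ∑ k ∈ Finset.range 10,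
    if signal u i k = s then
      totalWeight i * cardWeight k *
        ∑ l ∈ Finset.range 10, cardWeight l * integerGain u i k j (finalTotal m j l)
    else 0

/-- Contribution of the signals `s₁, s₂` and Banker's two-card total `j` to `2 * 13 ^ 9` times the
payoff for `θ = 1 / 2`. -/
def cell (u₁ u₂ s₁ s₂ j : ℕ) (m : Bool) : ℤ :=
  totalWeight j *
    (signalGain u₁ s₁ j m * signalWeight u₂ s₂ + signalWeight u₁ s₁ * signalGain u₂ s₂ j m)

/-- Whether Banker draws at `(s₁, s₂, j)` under `T`. -/
def drawsAt (T : BankerStrategy) (s₁ s₂ j : ℕ) : Bool := decide ((s₁, s₂, j) ∈ T.1)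

lemma bankerTotal_eq_finalTotal (T : BankerStrategy) (s₁ s₂ j l : ℕ) :
    bankerTotal T s₁ s₂ j l = finalTotal (drawsAt T s₁ s₂ j) j l := by
  simp [bankerTotal, finalTotal, drawsAt]

lemma totalProb_eq (i : ℕ) : totalProb i = (totalWeight i : ℝ) / 13 ^ 2 := by
  unfold totalProb totalWeight; push_cast; rfl

lemma cardProb_eq (i : ℕ) : cardProb i = (cardWeight i : ℝ) / 13 := by
  unfold cardProb cardWeight; push_cast; rfl

lemma playerGain_eq (u i k j b : ℕ) : playerGain u i k j b = (integerGain u i k j b : ℝ) := by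
  unfold playerGain integerGain compareTotals
  split_ifs <;> simp

lemma signal_mem_range (u i k : ℕ) (hk : k < 10) : signal u i k ∈ Finset.range 12 := by
  unfold signal; split_ifs
  · simp
  · simp; omega
  · simp

/-- A double sum over signals of products of sums over the fibers is a double sum over the total
space. -/
lemma sum_fiber_mul_sum_fiber {α : Type*} (X : Finset α) (S : Finset ℕ) (σ τ : α → ℕ)
    (hσ : ∀ x ∈ X, σ x ∈ S) (hτ : ∀ x ∈ X, τ x ∈ S) (a b : α → ℕ → ℕ → ℤ) :
    ∑ s ∈ S, ∑ t ∈ S, (∑ x ∈ X, if σ x = s then a x s t else 0) *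
        (∑ y ∈ X, if τ y = t then b y s t else 0)
      = ∑ x ∈ X, ∑ y ∈ X, a x (σ x) (τ y) * b y (σ x) (τ y) := by
  have h : ∀ s ∈ S, ∀ t ∈ S, (∑ x ∈ X, if σ x = s then a x s t else 0) *
        (∑ y ∈ X, if τ y = t then b y s t else 0)
      = ∑ x ∈ X, ∑ y ∈ X, if σ x = s then (if τ y = t then a x s t * b y s t else 0) else 0 := by
    intro s _ t _
    rw [Finset.sum_mul_sum]
    refine Finset.sum_congr rfl fun x _ => Finset.sum_congr rfl fun y _ => ?_
    split_ifs <;> simp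
  rw [Finset.sum_congr rfl fun s hs => Finset.sum_congr rfl fun t ht => h s hs t ht]
  rw [Finset.sum_congr rfl fun s _ => Finset.sum_comm, Finset.sum_comm]
  refine Finset.sum_congr rfl fun x hx => ?_
  rw [Finset.sum_congr rfl fun s _ => Finset.sum_comm, Finset.sum_comm]
  refine Finset.sum_congr rfl fun y hy => ?_
  rw [Finset.sum_eq_single (σ x), Finset.sum_eq_single (τ y)]
  · simp
  · intro t _ ht
    simp [Ne.symm ht]
  · exact fun h => absurd (hτ y hy) h
  · intro t _ ht
    simp [Ne.symm ht]
  · exact fun h => absurd (hσ x hx) h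

/-- The cells with Banker's two-card total `j`, summed over the signals. -/
lemma sum_cell (u₁ u₂ j : ℕ) (d : ℕ → ℕ → ℕ → Bool) :
    ∑ s₁ ∈ Finset.range 12, ∑ s₂ ∈ Finset.range 12, cell u₁ u₂ s₁ s₂ j (d s₁ s₂ j)
      = ∑ i₁ ∈ Finset.range 10, ∑ k₁ ∈ Finset.range 10, ∑ i₂ ∈ Finset.range 10,
        ∑ k₂ ∈ Finset.range 10, ∑ l ∈ Finset.range 10,
        totalWeight i₁ * totalWeight i₂ * totalWeight j * cardWeight k₁ * cardWeight k₂ *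
          cardWeight l *
          (integerGain u₁ i₁ k₁ j (finalTotal (d (signal u₁ i₁ k₁) (signal u₂ i₂ k₂) j) j l)
          + integerGain u₂ i₂ k₂ j
            (finalTotal (d (signal u₁ i₁ k₁) (signal u₂ i₂ k₂) j) j l)) := by
  have hX : ∀ u, ∀ x ∈ Finset.range 10 ×ˢ Finset.range 10,
      signal u x.1 x.2 ∈ Finset.range 12 := fun u x hx =>
    signal_mem_range u x.1 x.2 (by simpa using (Finset.mem_product.1 hx).2)
  -- The gain of Player 1 sits in the first factor here, that of Player 2 in the second factor
  -- below. It depends on both signals through Banker's decision `d`.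
  have key₁ := sum_fiber_mul_sum_fiber (Finset.range 10 ×ˢ Finset.range 10) (Finset.range 12)
    (fun x => signal u₁ x.1 x.2) (fun x => signal u₂ x.1 x.2) (hX u₁) (hX u₂)
    (fun x s t => totalWeight x.1 * cardWeight x.2 * ∑ l ∈ Finset.range 10,
      cardWeight l * integerGain u₁ x.1 x.2 j (finalTotal (d s t j) j l))
    (fun y _ _ => totalWeight y.1 * cardWeight y.2)
  have key₂ := sum_fiber_mul_sum_fiber (Finset.range 10 ×ˢ Finset.range 10) (Finset.range 12)
    (fun x => signal u₁ x.1 x.2) (fun x => signal u₂ x.1 x.2) (hX u₁) (hX u₂)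
    (fun x _ _ => totalWeight x.1 * cardWeight x.2)
    (fun y s t => totalWeight y.1 * cardWeight y.2 * ∑ l ∈ Finset.range 10,
      cardWeight l * integerGain u₂ y.1 y.2 j (finalTotal (d s t j) j l))
  simp only [Finset.sum_product] at key₁ key₂
  trans totalWeight j *
    (∑ s₁ ∈ Finset.range 12, ∑ s₂ ∈ Finset.range 12,
        signalGain u₁ s₁ j (d s₁ s₂ j) * signalWeight u₂ s₂
      + ∑ s₁ ∈ Finset.range 12, ∑ s₂ ∈ Finset.range 12,
        signalWeight u₁ s₁ * signalGain u₂ s₂ j (d s₁ s₂ j))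
  · simp only [cell, mul_add, Finset.sum_add_distrib, Finset.mul_sum]
  simp only [signalGain, signalWeight]
  rw [key₁, key₂, ← Finset.sum_add_distrib, Finset.mul_sum]
  refine Finset.sum_congr rfl fun i₁ _ => ?_
  rw [← Finset.sum_add_distrib, Finset.mul_sum]
  refine Finset.sum_congr rfl fun k₁ _ => ?_
  rw [← Finset.sum_add_distrib, Finset.mul_sum]
  refine Finset.sum_congr rfl fun i₂ _ => ?_
  rw [← Finset.sum_add_distrib, Finset.mul_sum]
  refine Finset.sum_congr rfl fun k₂ _ => ?_
  simp only [mul_add, Finset.mul_sum, Finset.sum_mul, ← Finset.sum_add_distrib]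
  refine Finset.sum_congr rfl fun l _ => ?_
  ring

/-- The payoff for `θ = 1 / 2` as a sum over Banker's information sets. -/
theorem payoff_half_eq (u₁ u₂ : ℕ) (T : BankerStrategy) :
    payoff (1 / 2) u₁ u₂ T =
      ((∑ j ∈ Finset.range 10, ∑ s₁ ∈ Finset.range 12, ∑ s₂ ∈ Finset.range 12,
        cell u₁ u₂ s₁ s₂ j (drawsAt T s₁ s₂ j) : ℤ) : ℝ) / (2 * 13 ^ 9) := by
  simp only [sum_cell]
  push_cast
  simp only [Finset.sum_div]
  unfold payoff
  rw [Finset.sum_congr rfl fun i₁ _ => Finset.sum_comm, Finset.sum_comm]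
  refine Finset.sum_congr rfl fun j _ => Finset.sum_congr rfl fun i₁ _ => ?_
  rw [Finset.sum_comm]
  refine Finset.sum_congr rfl fun k₁ _ => Finset.sum_congr rfl fun i₂ _ =>
    Finset.sum_congr rfl fun k₂ _ => Finset.sum_congr rfl fun l _ => ?_
  rw [bankerTotal_eq_finalTotal, playerGain_eq, playerGain_eq, totalProb_eq, totalProb_eq,
    totalProb_eq, cardProb_eq, cardProb_eq, cardProb_eq]
  field_simp
  ring

/-! ### One-Player tables -/

/-- Values of `signalGain`: by strategy, signal and Banker's two-card total, the entry for standing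
followed by the entry for drawing. -/
def gainTable : List (List (List (ℤ × ℤ))) :=
  [[
    [(3328, -1156), (1196, -1648), (-468, -2032), (-2132, -2416), (-3796, -2800), (-4628, -2992),
      (-4628, -2992), (-4628, -2992), (-4628, -4628), (-4628, -4628)],
    [(1157, -36), (832, -111), (299, -234), (-117, -330), (-533, -426), (-949, -522), (-1157, -570),
      (-1157, -570), (-1157, -1157), (-1157, -1157)],
    [(1157, 142), (1157, 142), (832, 67), (299, -56), (-117, -152), (-533, -248), (-949, -344),
      (-1157, -392), (-1157, -1157), (-1157, -1157)],
    [(1157, 320), (1157, 320), (1157, 320), (832, 245), (299, 122), (-117, 26), (-533, -70),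
      (-949, -166), (-1157, -1157), (-1157, -1157)],
    [(1157, 498), (1157, 498), (1157, 498), (1157, 498), (832, 423), (299, 300), (-117, 204),
      (-533, 108), (-1157, -1157), (-1157, -1157)],
    [(1157, 676), (1157, 676), (1157, 676), (1157, 676), (1157, 676), (832, 601), (299, 478),
      (-117, 382), (-1157, -1157), (-1157, -1157)],
    [(949, 486), (741, 438), (741, 438), (741, 438), (741, 438), (741, 438), (416, 363),
      (-117, 240), (-1157, -1157), (-1157, -1157)],
    [(949, 344), (533, 248), (325, 200), (325, 200), (325, 200), (325, 200), (325, 200), (0, 125),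
      (-1157, -1157), (-1157, -1157)],
    [(949, 202), (533, 106), (117, 10), (-91, -38), (-91, -38), (-91, -38), (-91, -38), (-91, -38),
      (-1157, -1157), (-1157, -1157)],
    [(949, 60), (533, -36), (117, -132), (-299, -228), (-507, -276), (-507, -276), (-507, -276),
      (-507, -276), (-1157, -1157), (-1157, -1157)],
    [(8112, 3744), (8112, 3744), (8112, 3744), (8112, 3744), (8112, 3744), (5408, 3120), (0, 1872),
      (-5408, 624), (-8112, -8112), (-8112, -8112)],
    [(5408, 5408), (5408, 5408), (5408, 5408), (5408, 5408), (5408, 5408), (5408, 5408),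
      (5408, 5408), (5408, 5408), (2704, 2704), (-2704, -2704)]],
   [
    [(4160, -900), (2028, -1392), (364, -1776), (-1300, -2160), (-2964, -2544), (-4628, -2928),
      (-5460, -3120), (-5460, -3120), (-5460, -5460), (-5460, -5460)],
    [(1365, 60), (1040, -15), (507, -138), (91, -234), (-325, -330), (-741, -426), (-1157, -522),
      (-1365, -570), (-1365, -1365), (-1365, -1365)],
    [(1365, 270), (1365, 270), (1040, 195), (507, 72), (91, -24), (-325, -120), (-741, -216),
      (-1157, -312), (-1365, -1365), (-1365, -1365)],
    [(1365, 480), (1365, 480), (1365, 480), (1040, 405), (507, 282), (91, 186), (-325, 90),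
      (-741, -6), (-1365, -1365), (-1365, -1365)],
    [(1365, 690), (1365, 690), (1365, 690), (1365, 690), (1040, 615), (507, 492), (91, 396),
      (-325, 300), (-1365, -1365), (-1365, -1365)],
    [(1157, 532), (949, 484), (949, 484), (949, 484), (949, 484), (624, 409), (91, 286),
      (-325, 190), (-1365, -1365), (-1365, -1365)],
    [(1157, 422), (741, 326), (533, 278), (533, 278), (533, 278), (533, 278), (208, 203),
      (-325, 80), (-1365, -1365), (-1365, -1365)],
    [(1157, 312), (741, 216), (325, 120), (117, 72), (117, 72), (117, 72), (117, 72), (-208, -3),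
      (-1365, -1365), (-1365, -1365)],
    [(1157, 202), (741, 106), (325, 10), (-91, -86), (-299, -134), (-299, -134), (-299, -134),
      (-299, -134), (-1365, -1365), (-1365, -1365)],
    [(1157, 92), (741, -4), (325, -100), (-91, -196), (-507, -292), (-715, -340), (-715, -340),
      (-715, -340), (-1365, -1365), (-1365, -1365)],
    [(5408, 2912), (5408, 2912), (5408, 2912), (5408, 2912), (5408, 2912), (5408, 2912),
      (2704, 2288), (-2704, 1040), (-5408, -5408), (-5408, -5408)],
    [(5408, 5408), (5408, 5408), (5408, 5408), (5408, 5408), (5408, 5408), (5408, 5408),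
      (5408, 5408), (5408, 5408), (2704, 2704), (-2704, -2704)]]]

/-- Values of `signalWeight`, by strategy and signal. -/
def weightTable : List (List ℤ) :=
  [[356, 89, 89, 89, 89, 89, 89, 89, 89, 89, 624, 416],
   [420, 105, 105, 105, 105, 105, 105, 105, 105, 105, 416, 416]]

/-- Lookup of `signalGain u s j m` in `gainTable`. -/
def tabulatedGain (u s j : ℕ) (m : Bool) : ℤ :=
  let e := ((gainTable.getD u []).getD s []).getD j (0, 0)
  if m then e.2 else e.1

/-- Lookup of `signalWeight u s` in `weightTable`. -/
def tabulatedWeight (u s : ℕ) : ℤ := (weightTable.getD u []).getD s 0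

/-- `cell`, computed from the tables. -/
def tabulatedCell (u₁ u₂ s₁ s₂ j : ℕ) (m : Bool) : ℤ :=
  totalWeight j * (tabulatedGain u₁ s₁ j m * tabulatedWeight u₂ s₂
    + tabulatedWeight u₁ s₁ * tabulatedGain u₂ s₂ j m)

lemma signalWeight_eq_table : ∀ u < 2, ∀ s < 12, signalWeight u s = tabulatedWeight u s := by
  decide +kernel

lemma signalGain_eq_table :
    ∀ u < 2, ∀ s < 12, ∀ j < 10, ∀ m, signalGain u s j m = tabulatedGain u s j m := by
  decide +kernel

lemma cell_eq_table {u₁ u₂ s₁ s₂ j : ℕ} (hu₁ : u₁ < 2) (hu₂ : u₂ < 2) (hs₁ : s₁ < 12)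
    (hs₂ : s₂ < 12) (hj : j < 10) (m : Bool) :
    cell u₁ u₂ s₁ s₂ j m = tabulatedCell u₁ u₂ s₁ s₂ j m := by
  simp only [cell, tabulatedCell, signalWeight_eq_table _ hu₁ _ hs₁,
    signalWeight_eq_table _ hu₂ _ hs₂, signalGain_eq_table _ hu₁ _ hs₁ _ hj,
    signalGain_eq_table _ hu₂ _ hs₂ _ hj]

/-! ### The four table strategies and their payoffs -/

/-- Banker's drawing rule given by the table, with free choices `a` at `(6, 10, 6)` and `b` at
`(10, 6, 6)`. -/
def tableRule (a b : Bool) (s₁ s₂ j : ℕ) : Bool :=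
  if s₁ = 11 ∧ s₂ = 11 then false
  else if (s₁, s₂, j) = (6, 10, 6) then a
  else if (s₁, s₂, j) = (10, 6, 6) then b
  else decide (j ≤ maxDrawingTotal s₁ s₂)

/-- The pure strategies of Banker described by the table. -/
def tableStrategy (a b : Bool) : BankerStrategy :=
  ⟨infoSets.filter fun s => tableRule a b s.1 s.2.1 s.2.2 = true,
    Finset.mem_powerset.2 (Finset.filter_subset _ _)⟩

/-- All triples of signals and two-card totals of Banker. -/
def triples : Finset (ℕ × ℕ × ℕ) := Finset.range 12 ×ˢ Finset.range 12 ×ˢ Finset.range 10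

lemma mem_triples {s : ℕ × ℕ × ℕ} : s ∈ triples ↔ s.1 < 12 ∧ s.2.1 < 12 ∧ s.2.2 < 10 := by
  simp [triples]

lemma mem_infoSets {s : ℕ × ℕ × ℕ} :
    s ∈ infoSets ↔ (s.1 < 12 ∧ s.2.1 < 12 ∧ s.2.2 < 8) ∧ ¬ (s.1 = 11 ∧ s.2.1 = 11) := by
  simp [infoSets]

lemma mem_infoSets_of_mem (T : BankerStrategy) {s : ℕ × ℕ × ℕ} (hs : s ∈ T.1) : s ∈ infoSets :=
  Finset.mem_powerset.1 T.2 hs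

lemma maxDrawingTotal_lt_eight : ∀ s₁ < 12, ∀ s₂ < 12, maxDrawingTotal s₁ s₂ < 8 := by
  decide +kernel

lemma lt_eight_of_tableRule {a b : Bool} {s₁ s₂ j : ℕ} (h₁ : s₁ < 12) (h₂ : s₂ < 12)
    (h : tableRule a b s₁ s₂ j = true) : j < 8 ∧ ¬ (s₁ = 11 ∧ s₂ = 11) := by
  have hm := maxDrawingTotal_lt_eight s₁ h₁ s₂ h₂
  unfold tableRule at h
  split_ifs at h with hn h₃ h₄
  · simp only [Prod.mk.injEq] at h₃; omega
  · simp only [Prod.mk.injEq] at h₄; omega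
  · exact ⟨(of_decide_eq_true h).trans_lt hm, hn⟩

lemma drawsAt_tableStrategy (a b : Bool) {s₁ s₂ j : ℕ} (h₁ : s₁ < 12) (h₂ : s₂ < 12) :
    drawsAt (tableStrategy a b) s₁ s₂ j = tableRule a b s₁ s₂ j := by
  have h := lt_eight_of_tableRule (a := a) (b := b) (j := j) h₁ h₂
  rw [Bool.eq_iff_iff, drawsAt, decide_eq_true_iff, tableStrategy, Finset.mem_filter, mem_infoSets]
  tauto

/-- `2 * 13 ^ 9` times the payoffs of the table strategies. -/
def tableValue (a b : Bool) (u₁ u₂ : ℕ) : ℤ :=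
  match u₁, u₂ with
  | 0, 0 => -189045056 + 2136576 * (a.toNat + b.toNat)
  | 0, _ => -185939664 - 945152 * a.toNat + 3095040 * b.toNat
  | _, 0 => -185939664 + 3095040 * a.toNat - 945152 * b.toNat
  | _, _ => -182744160 - 732160 * (a.toNat + b.toNat)

lemma sum_tabulatedCell_tableRule : ∀ a b, ∀ u₁ < 2, ∀ u₂ < 2,
    ∑ j ∈ Finset.range 10, ∑ s₁ ∈ Finset.range 12, ∑ s₂ ∈ Finset.range 12,
      tabulatedCell u₁ u₂ s₁ s₂ j (tableRule a b s₁ s₂ j) = tableValue a b u₁ u₂ := by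
  decide +kernel

lemma payoff_tableStrategy (a b : Bool) {u₁ u₂ : ℕ} (hu₁ : u₁ < 2) (hu₂ : u₂ < 2) :
    payoff (1 / 2) u₁ u₂ (tableStrategy a b) = (tableValue a b u₁ u₂ : ℝ) / (2 * 13 ^ 9) := by
  rw [payoff_half_eq, ← sum_tabulatedCell_tableRule a b u₁ hu₁ u₂ hu₂]
  refine congrArg (fun z : ℤ => (z : ℝ) / (2 * 13 ^ 9)) ?_
  refine Finset.sum_congr rfl fun j hj => Finset.sum_congr rfl fun s₁ h₁ =>
    Finset.sum_congr rfl fun s₂ h₂ => ?_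
  rw [Finset.mem_range] at hj h₁ h₂
  rw [drawsAt_tableStrategy a b h₁ h₂, cell_eq_table hu₁ hu₂ h₁ h₂ hj]

/-! ### A guarantee for correlated Players -/

/-- Banker decides separately at each triple, so the sum of cellwise minima bounds every `T` from
below. The weights 1, 1, 3 are a correlated strategy scaled by 5. -/
lemma le_sum_min_tabulatedCell : (-920204992 : ℤ) ≤
    ∑ j ∈ Finset.range 10, ∑ s₁ ∈ Finset.range 12, ∑ s₂ ∈ Finset.range 12,
      min (tabulatedCell 0 1 s₁ s₂ j true + tabulatedCell 1 0 s₁ s₂ j true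
          + 3 * tabulatedCell 1 1 s₁ s₂ j true)
        (tabulatedCell 0 1 s₁ s₂ j false + tabulatedCell 1 0 s₁ s₂ j false
          + 3 * tabulatedCell 1 1 s₁ s₂ j false) := by
  decide +kernel

/-- What correlated Players can guarantee. -/
lemma correlated_guarantee (T : BankerStrategy) :
    -920204992 / (2 * 13 ^ 9) ≤
      payoff (1 / 2) 0 1 T + payoff (1 / 2) 1 0 T + 3 * payoff (1 / 2) 1 1 T := by
  have h : (-920204992 : ℤ) ≤ ∑ j ∈ Finset.range 10, ∑ s₁ ∈ Finset.range 12,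
      ∑ s₂ ∈ Finset.range 12, (cell 0 1 s₁ s₂ j (drawsAt T s₁ s₂ j)
        + cell 1 0 s₁ s₂ j (drawsAt T s₁ s₂ j) + 3 * cell 1 1 s₁ s₂ j (drawsAt T s₁ s₂ j)) := by
    refine le_sum_min_tabulatedCell.trans ?_
    refine Finset.sum_le_sum fun j hj => Finset.sum_le_sum fun s₁ h₁ =>
      Finset.sum_le_sum fun s₂ h₂ => ?_
    rw [Finset.mem_range] at hj h₁ h₂
    rw [cell_eq_table zero_lt_two one_lt_two h₁ h₂ hj, cell_eq_table one_lt_two zero_lt_two h₁ h₂ hj,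
      cell_eq_table one_lt_two one_lt_two h₁ h₂ hj]
    cases drawsAt T s₁ s₂ j
    · exact min_le_right _ _
    · exact min_le_left _ _
  simp only [Finset.sum_add_distrib, ← Finset.mul_sum] at h
  rw [payoff_half_eq, payoff_half_eq, payoff_half_eq, ← mul_div_assoc, ← add_div, ← add_div]
  refine div_le_div_of_nonneg_right ?_ (by positivity)
  exact_mod_cast h

/-! ### Sign of the effect of drawing -/

/-- Coefficients `(α, β)` such that `112` times the change of the cell `(s₁, s₂, j)` when Banker
draws instead of standing is `α + β * r`, if the Players use `(r, r)` with
`112 * r ^ 2 + 319 * r = 321`. -/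
def drawEffect (s₁ s₂ j : ℕ) : ℤ × ℤ :=
  let d := fun u₁ u₂ => tabulatedCell u₁ u₂ s₁ s₂ j true - tabulatedCell u₁ u₂ s₁ s₂ j false
  let c := d 0 0 - d 0 1 - d 1 0 + d 1 1
  (112 * d 0 0 + 321 * c, 112 * (d 0 1 + d 1 0 - 2 * d 0 0) - 319 * c)

-- The effect is affine in `r` once `r²` is eliminated, so a common strict sign at the two rational
-- bounds 0.788166 and 0.788167 persists between them. At the two exceptional triples both
-- coefficients vanish, so indifference is exact.
set_option synthInstance.maxHeartbeats 400000 in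
set_option synthInstance.maxSize 100000 in
lemma drawEffect_sign : ∀ s₁ < 12, ∀ s₂ < 12, ∀ j < 8, ¬ (s₁ = 11 ∧ s₂ = 11) →
    if (s₁, s₂, j) = (6, 10, 6) ∨ (s₁, s₂, j) = (10, 6, 6) then drawEffect s₁ s₂ j = (0, 0)
    else if j ≤ maxDrawingTotal s₁ s₂ then
      1000000 * (drawEffect s₁ s₂ j).1 + 788166 * (drawEffect s₁ s₂ j).2 < 0 ∧
      1000000 * (drawEffect s₁ s₂ j).1 + 788167 * (drawEffect s₁ s₂ j).2 < 0
    else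
      0 < 1000000 * (drawEffect s₁ s₂ j).1 + 788166 * (drawEffect s₁ s₂ j).2 ∧
      0 < 1000000 * (drawEffect s₁ s₂ j).1 + 788167 * (drawEffect s₁ s₂ j).2 := by
  decide +kernel

/-! ### The saddle of the four bilinear forms -/

/-- The maximin probability of drawing on 5. -/
noncomputable def drawProb : ℝ := (-319 + Real.sqrt 245569) / 224

lemma sqrt_bounds : 495.549190 < Real.sqrt 245569 ∧ Real.sqrt 245569 < 495.549191 := by
  constructor
  · exact Real.lt_sqrt_of_sq_lt (by norm_num)
  · rw [Real.sqrt_lt' (by norm_num)]; norm_num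

/-- This is Banker's indifference equation: in `tableValue`, the coefficients of `a.toNat`, and
likewise those of `b.toNat`, combine at `(r, r)` to `6656 * (321 - 319 r - 112 r²)`. -/
lemma drawProb_sq : 112 * drawProb ^ 2 = 321 - 319 * drawProb := by
  have h : Real.sqrt 245569 ^ 2 = 245569 := Real.sq_sqrt (by norm_num)
  unfold drawProb
  linear_combination (112 / 224 ^ 2) * h

lemma lt_drawProb : 0.788166 < drawProb := by
  have h := sqrt_bounds.1
  unfold drawProb; norm_num at h ⊢; linarith

lemma drawProb_lt : drawProb < 0.788167 := by
  have h := sqrt_bounds.2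
  unfold drawProb; norm_num at h ⊢; linarith

/-- `2 * 13 ^ 9` times the lower value. -/
noncomputable def scaledValue : ℝ :=
  -189045056 + 5632 * 321 / 7 + (6210784 - 5632 * 319 / 7) * drawProb

lemma scaledValue_div : scaledValue / (2 * 13 ^ 9) =
    5 * (-1933207795 + 260493 * Real.sqrt 245569) / (98 * 13 ^ 9) := by
  unfold scaledValue drawProb; ring

/-- `2 * 13 ^ 9` times the payoff of `(x, y)` against a table strategy. -/
noncomputable def tableForm (a b : Bool) (x y : ℝ) : ℝ :=
  (1 - x) * (1 - y) * tableValue a b 0 0 + (1 - x) * y * tableValue a b 0 1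
    + x * (1 - y) * tableValue a b 1 0 + x * y * tableValue a b 1 1

lemma indepPayoff_tableStrategy (a b : Bool) (p : ℝ × ℝ) :
    indepPayoff (1 / 2) p (tableStrategy a b) = tableForm a b p.1 p.2 / (2 * 13 ^ 9) := by
  unfold indepPayoff tableForm
  rw [payoff_tableStrategy a b zero_lt_two zero_lt_two,
    payoff_tableStrategy a b zero_lt_two one_lt_two,
    payoff_tableStrategy a b one_lt_two zero_lt_two,
    payoff_tableStrategy a b one_lt_two one_lt_two]
  ring

lemma tableForm_drawProb (a b : Bool) : tableForm a b drawProb drawProb = scaledValue := by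
  have h := drawProb_sq
  cases a <;> cases b <;> simp [tableForm, tableValue, scaledValue]
  -- In each case the numerator is the coefficient of `x * y` in the form, that is, of `r²` on the
  -- diagonal.
  · linear_combination (90112 / 112) * h
  · linear_combination (-655360 / 112) * h
  · linear_combination (-655360 / 112) * h
  · linear_combination (-1400832 / 112) * h

/-- Against `(x, y)` other than the maximin strategy, one of the four table strategies keeps the
Players strictly below the lower value. -/
lemma exists_tableForm_lt {x y : ℝ} (hx : x ∈ Set.Icc (0 : ℝ) 1) (hy : y ∈ Set.Icc (0 : ℝ) 1)
    (hne : (x, y) ≠ (drawProb, drawProb)) : ∃ a b, tableForm a b x y < scaledValue := by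
  have hr := drawProb_sq
  have h₁ := lt_drawProb
  have h₂ := drawProb_lt
  obtain ⟨hx₀, hx₁⟩ := hx
  obtain ⟨hy₀, hy₁⟩ := hy
  obtain ⟨v, rfl⟩ : ∃ v, x = drawProb + v := ⟨x - drawProb, by ring⟩
  obtain ⟨w, rfl⟩ : ∃ w, y = drawProb + w := ⟨y - drawProb, by ring⟩
  have hvw : v ≠ 0 ∨ w ≠ 0 := by
    by_contra! h
    exact hne (by simp [h.1, h.2])
  -- The Taylor expansion at `(r, r)` is exact because the form is bilinear; the constant term is
  -- the same for all four forms.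
  have expand : ∀ a b, tableForm a b (drawProb + v) (drawProb + w) = scaledValue
      + ((1 - drawProb) * (tableValue a b 1 0 - tableValue a b 0 0)
        + drawProb * (tableValue a b 1 1 - tableValue a b 0 1)) * v
      + ((1 - drawProb) * (tableValue a b 0 1 - tableValue a b 0 0)
        + drawProb * (tableValue a b 1 1 - tableValue a b 1 0)) * w
      + (tableValue a b 0 0 - tableValue a b 0 1 - tableValue a b 1 0 + tableValue a b 1 1)
        * (v * w) := by
    intro a b
    rw [← tableForm_drawProb a b]
    unfold tableForm
    ring
  -- Banker draws at `(10, 6, 6)` when Player 1 draws too often (`v ≥ 0`), and at `(6, 10, 6)` when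
  -- Player 2 does: a Player who stands is then less likely to hold 5.
  rcases le_or_gt 0 v with hv | hv <;> rcases le_or_gt 0 w with hw | hw
  · refine ⟨true, true, ?_⟩
    rw [expand]
    simp only [tableValue]
    norm_num
    rcases hvw with h | h
    · have : 0 < v := lt_of_le_of_ne hv h.symm
      nlinarith [mul_nonneg hv hw]
    · have : 0 < w := lt_of_le_of_ne hw h.symm
      nlinarith [mul_nonneg hv hw]
  · refine ⟨false, true, ?_⟩
    rw [expand]
    simp only [tableValue]
    norm_num
    -- Here the product term has the unfavourable sign; since `v ≤ 1 - r`, the linear term in `w`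
    -- outweighs it.
    nlinarith [mul_nonneg hv (sub_nonneg.2 h₁.le), mul_nonneg hv (sub_nonneg.2 h₂.le),
      mul_pos (neg_pos.2 hw) (sub_pos.2 h₁), mul_pos (neg_pos.2 hw) (sub_pos.2 h₂),
      mul_nonneg (neg_pos.2 hw).le (sub_nonneg.2 hx₁)]
  · refine ⟨true, false, ?_⟩
    rw [expand]
    simp only [tableValue]
    norm_num
    nlinarith [mul_nonneg hw (sub_nonneg.2 h₁.le), mul_nonneg hw (sub_nonneg.2 h₂.le),
      mul_pos (neg_pos.2 hv) (sub_pos.2 h₁), mul_pos (neg_pos.2 hv) (sub_pos.2 h₂),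
      mul_nonneg (neg_pos.2 hv).le (sub_nonneg.2 hy₁)]
  · refine ⟨false, false, ?_⟩
    rw [expand]
    simp only [tableValue]
    norm_num
    -- The product term is again positive, but its coefficient 90112 is small against the slopes, so
    -- the crude bound `-w ≤ 1 + r` suffices.
    nlinarith [mul_pos (neg_pos.2 hv) (sub_pos.2 h₁), mul_pos (neg_pos.2 hv) (sub_pos.2 h₂),
      mul_pos (neg_pos.2 hw) (sub_pos.2 h₁), mul_pos (neg_pos.2 hw) (sub_pos.2 h₂),
      mul_nonneg (neg_pos.2 hv).le (add_nonneg hy₀ zero_le_one)]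

/-! ### Banker's best responses to the maximin strategy -/

/-- `2 * 13 ^ 9` times the contribution of the triple `s` to the Players' gain when they use `p`
and `m` says whether Banker draws. -/
noncomputable def mixedCell (p : ℝ × ℝ) (s : ℕ × ℕ × ℕ) (m : Bool) : ℝ :=
  (1 - p.1) * (1 - p.2) * cell 0 0 s.1 s.2.1 s.2.2 m
    + (1 - p.1) * p.2 * cell 0 1 s.1 s.2.1 s.2.2 m
    + p.1 * (1 - p.2) * cell 1 0 s.1 s.2.1 s.2.2 m + p.1 * p.2 * cell 1 1 s.1 s.2.1 s.2.2 m

lemma indepPayoff_half_eq (p : ℝ × ℝ) (T : BankerStrategy) :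
    indepPayoff (1 / 2) p T =
      (∑ s ∈ triples, mixedCell p s (decide (s ∈ T.1))) / (2 * 13 ^ 9) := by
  have h : ∀ u₁ u₂, payoff (1 / 2) u₁ u₂ T =
      (∑ s ∈ triples, (cell u₁ u₂ s.1 s.2.1 s.2.2 (decide (s ∈ T.1)) : ℝ)) / (2 * 13 ^ 9) := by
    intro u₁ u₂
    rw [payoff_half_eq]
    simp only [triples, Finset.sum_product, drawsAt]
    push_cast
    rw [Finset.sum_comm, Finset.sum_congr rfl fun s₁ _ => Finset.sum_comm]
  simp only [indepPayoff, h, mixedCell, Finset.sum_add_distrib, ← Finset.mul_sum]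
  ring

/-- At the maximin strategy, the cell of an information set changes with the sign prescribed by the
table when Banker draws. -/
lemma mixedCell_drawProb_sign {s : ℕ × ℕ × ℕ} (hs : s ∈ infoSets) :
    if s = (6, 10, 6) ∨ s = (10, 6, 6) then
      mixedCell (drawProb, drawProb) s true = mixedCell (drawProb, drawProb) s false
    else if s.2.2 ≤ maxDrawingTotal s.1 s.2.1 then
      mixedCell (drawProb, drawProb) s true < mixedCell (drawProb, drawProb) s false
    else mixedCell (drawProb, drawProb) s false < mixedCell (drawProb, drawProb) s true := by
  obtain ⟨s₁, s₂, j⟩ := s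
  obtain ⟨⟨h₁, h₂, hj⟩, hn⟩ := mem_infoSets.1 hs
  dsimp only at h₁ h₂ hj hn
  have hj' : j < 10 := by omega
  have key : 112 * (mixedCell (drawProb, drawProb) (s₁, s₂, j) true
      - mixedCell (drawProb, drawProb) (s₁, s₂, j) false)
      = (drawEffect s₁ s₂ j).1 + (drawEffect s₁ s₂ j).2 * drawProb := by
    simp only [mixedCell, drawEffect, cell_eq_table zero_lt_two zero_lt_two h₁ h₂ hj',
      cell_eq_table zero_lt_two one_lt_two h₁ h₂ hj',
      cell_eq_table one_lt_two zero_lt_two h₁ h₂ hj',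
      cell_eq_table one_lt_two one_lt_two h₁ h₂ hj']
    push_cast
    linear_combination ((tabulatedCell 0 0 s₁ s₂ j true - tabulatedCell 0 0 s₁ s₂ j false : ℝ)
      - (tabulatedCell 0 1 s₁ s₂ j true - tabulatedCell 0 1 s₁ s₂ j false)
      - (tabulatedCell 1 0 s₁ s₂ j true - tabulatedCell 1 0 s₁ s₂ j false)
      + (tabulatedCell 1 1 s₁ s₂ j true - tabulatedCell 1 1 s₁ s₂ j false)) * drawProb_sq
  have sign := drawEffect_sign s₁ h₁ s₂ h₂ j hj hn
  have hlo := lt_drawProb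
  have hhi := drawProb_lt
  generalize drawEffect s₁ s₂ j = e at key sign
  obtain ⟨α, β⟩ := e
  dsimp only at key sign ⊢
  split_ifs at sign ⊢
  · obtain ⟨rfl, rfl⟩ := Prod.mk.inj sign
    push_cast at key
    linarith
  · obtain ⟨ha, hb⟩ := sign
    have ha' : 1000000 * (α : ℝ) + 788166 * β < 0 := by exact_mod_cast ha
    have hb' : 1000000 * (α : ℝ) + 788167 * β < 0 := by exact_mod_cast hb
    -- The sign of the slope `β` decides which endpoint bounds `α + β * r`.
    rcases le_or_gt 0 (β : ℝ) with h | h <;> nlinarith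
  · obtain ⟨ha, hb⟩ := sign
    have ha' : 0 < 1000000 * (α : ℝ) + 788166 * β := by exact_mod_cast ha
    have hb' : 0 < 1000000 * (α : ℝ) + 788167 * β := by exact_mod_cast hb
    rcases le_or_gt 0 (β : ℝ) with h | h <;> nlinarith

/-- `T` follows the table, except possibly at the two information sets where Banker is
indifferent. -/
def FollowsTable (T : BankerStrategy) : Prop :=
  ∀ k₁ k₂ j : ℕ, (k₁, k₂, j) ∈ infoSets → (k₁, k₂, j) ≠ (6, 10, 6) → (k₁, k₂, j) ≠ (10, 6, 6) →
    ((k₁, k₂, j) ∈ T.1 ↔ j ≤ maxDrawingTotal k₁ k₂)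

lemma followsTable_tableStrategy (a b : Bool) : FollowsTable (tableStrategy a b) := by
  intro k₁ k₂ j hs h₁ h₂
  have hn := (mem_infoSets.1 hs).2
  rw [tableStrategy, Finset.mem_filter, and_iff_right hs, tableRule, if_neg hn, if_neg h₁,
    if_neg h₂, decide_eq_true_iff]

lemma FollowsTable.mixedCell_le {T : BankerStrategy} (hT : FollowsTable T) (T' : BankerStrategy)
    (s : ℕ × ℕ × ℕ) :
    mixedCell (drawProb, drawProb) s (decide (s ∈ T.1)) ≤
      mixedCell (drawProb, drawProb) s (decide (s ∈ T'.1)) := by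
  by_cases hs : s ∈ infoSets
  · have sign := mixedCell_drawProb_sign hs
    split_ifs at sign with h₁ h₂
    · cases decide (s ∈ T.1) <;> cases decide (s ∈ T'.1) <;> simp [sign]
    all_goals
      push Not at h₁
      have h := hT s.1 s.2.1 s.2.2 hs h₁.1 h₁.2
      simp only [Prod.mk.eta, h₂, iff_true, iff_false] at h
      by_cases h' : s ∈ T'.1 <;> simp [h, h', sign.le]
  -- Outside the information sets no strategy draws, so the two cells coincide.
  · have h : ∀ T : BankerStrategy, s ∉ T.1 := fun T h => hs (mem_infoSets_of_mem T h)
    simp [h]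

lemma FollowsTable.isBestResponse {T : BankerStrategy} (hT : FollowsTable T) :
    IsBestResponse (1 / 2) (drawProb, drawProb) T := by
  intro T'
  rw [indepPayoff_half_eq, indepPayoff_half_eq]
  exact div_le_div_of_nonneg_right (Finset.sum_le_sum fun s _ => hT.mixedCell_le T' s)
    (by positivity)

theorem isBestResponse_drawProb_iff (T : BankerStrategy) :
    IsBestResponse (1 / 2) (drawProb, drawProb) T ↔ FollowsTable T := by
  refine ⟨fun hT k₁ k₂ j hs h₁ h₂ => ?_, FollowsTable.isBestResponse⟩
  have hT₀ := followsTable_tableStrategy false false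
  have hle := hT (tableStrategy false false)
  rw [indepPayoff_half_eq, indepPayoff_half_eq, div_le_div_iff_of_pos_right (by positivity)] at hle
  -- Both strategies are optimal and one is cellwise no larger than the other, so equal totals force
  -- equality in every cell; strictness of the sign then determines the decision.
  have heq := (Finset.sum_eq_sum_iff_of_le fun s _ => hT₀.mixedCell_le T s).1
    (le_antisymm (Finset.sum_le_sum fun s _ => hT₀.mixedCell_le T s) hle) (k₁, k₂, j) (by
      have := (mem_infoSets.1 hs).1
      exact mem_triples.2 ⟨this.1, this.2.1, this.2.2.trans (by norm_num)⟩)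
  rw [← hT₀ k₁ k₂ j hs h₁ h₂]
  have sign := mixedCell_drawProb_sign hs
  rw [if_neg (by simp [h₁, h₂])] at sign
  have hne : mixedCell (drawProb, drawProb) (k₁, k₂, j) true ≠
      mixedCell (drawProb, drawProb) (k₁, k₂, j) false := by
    split_ifs at sign
    · exact sign.ne
    · exact sign.ne'
  by_cases ha : (k₁, k₂, j) ∈ T.1 <;>
    by_cases hb : (k₁, k₂, j) ∈ (tableStrategy false false).1 <;> simp only [ha, hb]
  · simp only [ha, hb, decide_true, decide_false] at heq
    exact absurd heq.symm hne
  · simp only [ha, hb, decide_true, decide_false] at heq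
    exact absurd heq hne

lemma indepPayoff_drawProb_tableStrategy (a b : Bool) :
    indepPayoff (1 / 2) (drawProb, drawProb) (tableStrategy a b) = scaledValue / (2 * 13 ^ 9) := by
  rw [indepPayoff_tableStrategy, tableForm_drawProb]

/-! ### From pure to mixed strategies: maximin and lower value -/

lemma le_mixedPayoff {θ c : ℝ} {p : ℝ × ℝ} (h : ∀ T, c ≤ indepPayoff θ p T)
    {q : BankerStrategy → ℝ} (hq : q ∈ bankerMixed) : c ≤ mixedPayoff θ p q := by
  calc c = ∑ T, q T * c := by rw [← Finset.sum_mul, hq.2, one_mul]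
    _ ≤ mixedPayoff θ p q :=
      Finset.sum_le_sum fun T _ => mul_le_mul_of_nonneg_left (h T) (hq.1 T)

lemma exists_le_indepPayoff (θ : ℝ) (p : ℝ × ℝ) : ∃ c, ∀ T, c ≤ indepPayoff θ p T :=
  let ⟨c, hc⟩ := (Set.finite_range (indepPayoff θ p)).bddBelow
  ⟨c, fun T => hc ⟨T, rfl⟩⟩

lemma bddBelow_mixedPayoff (θ : ℝ) (p : ℝ × ℝ) :
    BddBelow (Set.range fun q : bankerMixed => mixedPayoff θ p q) := by
  obtain ⟨c, hc⟩ := exists_le_indepPayoff θ p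
  exact ⟨c, by rintro _ ⟨q, rfl⟩; exact le_mixedPayoff hc q.2⟩

open Classical in
lemma single_mem_bankerMixed (T : BankerStrategy) :
    (Pi.single T 1 : BankerStrategy → ℝ) ∈ bankerMixed := single_mem_stdSimplex ℝ T

instance : Nonempty bankerMixed := ⟨⟨_, single_mem_bankerMixed (tableStrategy false false)⟩⟩

lemma guarantee_le_indepPayoff (θ : ℝ) (p : ℝ × ℝ) (T : BankerStrategy) :
    guarantee θ p ≤ indepPayoff θ p T := by
  classical
  refine (ciInf_le (bddBelow_mixedPayoff θ p) ⟨_, single_mem_bankerMixed T⟩).trans_eq ?_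
  simp [mixedPayoff, Pi.single_apply]

lemma IsBestResponse.guarantee_eq {θ : ℝ} {p : ℝ × ℝ} {T : BankerStrategy}
    (hT : IsBestResponse θ p T) : guarantee θ p = indepPayoff θ p T :=
  le_antisymm (guarantee_le_indepPayoff θ p T) (le_ciInf fun q => le_mixedPayoff hT q.2)

lemma guarantee_drawProb :
    guarantee (1 / 2) (drawProb, drawProb) = scaledValue / (2 * 13 ^ 9) := by
  rw [(followsTable_tableStrategy false false).isBestResponse.guarantee_eq,
    indepPayoff_drawProb_tableStrategy]

lemma guarantee_lt {p : ℝ × ℝ} (hp : p ∈ indepStrategies) (hne : p ≠ (drawProb, drawProb)) :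
    guarantee (1 / 2) p < scaledValue / (2 * 13 ^ 9) := by
  obtain ⟨a, b, h⟩ := exists_tableForm_lt hp.1 hp.2 hne
  refine (guarantee_le_indepPayoff _ p (tableStrategy a b)).trans_lt ?_
  rw [indepPayoff_tableStrategy]
  exact div_lt_div_of_pos_right h (by positivity)

lemma guarantee_le {p : ℝ × ℝ} (hp : p ∈ indepStrategies) :
    guarantee (1 / 2) p ≤ scaledValue / (2 * 13 ^ 9) := by
  by_cases h : p = (drawProb, drawProb)
  · rw [h, guarantee_drawProb]
  · exact (guarantee_lt hp h).le

lemma drawProb_mem : (drawProb, drawProb) ∈ indepStrategies := by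
  have h₁ := lt_drawProb
  have h₂ := drawProb_lt
  refine ⟨⟨?_, ?_⟩, ⟨?_, ?_⟩⟩ <;> dsimp only <;> linarith

theorem isMaximin_half_iff (p : ℝ × ℝ) :
    IsMaximin (1 / 2) p ↔ p = (drawProb, drawProb) := by
  constructor
  · rintro ⟨hp, hmax⟩
    by_contra hne
    have h := hmax drawProb_mem
    rw [Set.mem_ofPred_eq, guarantee_drawProb] at h
    exact absurd (guarantee_lt hp hne) h.not_gt
  · rintro rfl
    refine ⟨drawProb_mem, fun p hp => ?_⟩
    rw [Set.mem_ofPred_eq, guarantee_drawProb]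
    exact guarantee_le hp

theorem lowerValue_half : lowerValue (1 / 2) = scaledValue / (2 * 13 ^ 9) := by
  have : Nonempty indepStrategies := ⟨⟨_, drawProb_mem⟩⟩
  change (⨆ p : indepStrategies, guarantee (1 / 2) p) = _
  refine le_antisymm (ciSup_le fun p => guarantee_le p.2) ?_
  rw [← guarantee_drawProb]
  exact le_ciSup (f := fun p : indepStrategies => guarantee (1 / 2) (p : ℝ × ℝ))
    ⟨scaledValue / (2 * 13 ^ 9), by rintro _ ⟨p, rfl⟩; exact guarantee_le p.2⟩
    ⟨_, drawProb_mem⟩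

/-! ### Upper value and absence of a value -/

/-- Needed because a real supremum over an unbounded family is 0 by convention; compactness of the
square supplies the bound. -/
lemma bddAbove_mixedPayoff (θ : ℝ) (q : BankerStrategy → ℝ) :
    BddAbove (Set.range fun p : indepStrategies => mixedPayoff θ p q) := by
  have hc : IsCompact indepStrategies := isCompact_Icc.prod isCompact_Icc
  have hf : Continuous fun p : ℝ × ℝ => mixedPayoff θ p q := by
    unfold mixedPayoff indepPayoff; fun_prop
  have h := hc.bddAbove_image hf.continuousOn
  rwa [Set.image_eq_range] at h

theorem le_upperValue_half : -920204992 / 5 / (2 * 13 ^ 9) ≤ upperValue (1 / 2) := by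
  refine le_ciInf fun q => ?_
  have hle : ∀ p (hp : p ∈ indepStrategies), mixedPayoff (1 / 2) p q ≤
      ⨆ p : indepStrategies, mixedPayoff (1 / 2) p q := fun p hp =>
    le_ciSup (bddAbove_mixedPayoff (1 / 2) q) ⟨p, hp⟩
  -- Vertices of the square are pure pairs, so their average with weights 1, 1, 3 stays below the
  -- supremum although the correlated strategy itself is not in `indepStrategies`.
  have h₀₁ := hle (0, 1) (by simp [indepStrategies])
  have h₁₀ := hle (1, 0) (by simp [indepStrategies])
  have h₁₁ := hle (1, 1) (by simp [indepStrategies])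
  have h : -920204992 / (2 * 13 ^ 9) ≤ mixedPayoff (1 / 2) (0, 1) q
      + mixedPayoff (1 / 2) (1, 0) q + 3 * mixedPayoff (1 / 2) (1, 1) q := by
    calc (-920204992 / (2 * 13 ^ 9) : ℝ)
        = ∑ T, (q : BankerStrategy → ℝ) T * (-920204992 / (2 * 13 ^ 9)) := by
          rw [← Finset.sum_mul, q.2.2, one_mul]
      _ ≤ ∑ T, (q : BankerStrategy → ℝ) T *
            (payoff (1 / 2) 0 1 T + payoff (1 / 2) 1 0 T + 3 * payoff (1 / 2) 1 1 T) :=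
          Finset.sum_le_sum fun T _ =>
            mul_le_mul_of_nonneg_left (correlated_guarantee T) (q.2.1 T)
      _ = _ := by
          simp only [mixedPayoff, Finset.mul_sum, ← Finset.sum_add_distrib]
          refine Finset.sum_congr rfl fun T _ => ?_
          simp only [indepPayoff]
          ring
  have h5 : (-920204992 / 5 / (2 * 13 ^ 9) : ℝ) = -920204992 / (2 * 13 ^ 9) / 5 := by ring
  rw [h5]
  linarith

lemma scaledValue_lt : scaledValue < -920204992 / 5 := by
  have h := drawProb_lt
  unfold scaledValue
  norm_num at h ⊢
  linarith

theorem lowerValue_lt_upperValue_half : lowerValue (1 / 2) < upperValue (1 / 2) := by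
  refine lt_of_lt_of_le ?_ le_upperValue_half
  rw [lowerValue_half]
  exact div_lt_div_of_pos_right scaledValue_lt (by norm_num)

end BaccaraBanque

theorem mainTheorem4 :
    (∀ p : ℝ × ℝ, BaccaraBanque.IsMaximin (1 / 2) p ↔
      p = ((-319 + Real.sqrt 245569) / 224, (-319 + Real.sqrt 245569) / 224)) ∧
    |(-319 + Real.sqrt 245569) / 224 - 0.788166| < 0.0000005 ∧
    BaccaraBanque.lowerValue (1 / 2) =
      5 * (-1933207795 + 260493 * Real.sqrt 245569) / (98 * 13 ^ 9) ∧
    |5 * (-1933207795 + 260493 * Real.sqrt 245569) / (98 * 13 ^ 9) - (-0.00867999)|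
      < 0.000000005 ∧
    (∀ T : BaccaraBanque.BankerStrategy,
      BaccaraBanque.IsBestResponse (1 / 2)
          ((-319 + Real.sqrt 245569) / 224, (-319 + Real.sqrt 245569) / 224) T ↔
        ∀ k₁ k₂ j : ℕ, (k₁, k₂, j) ∈ BaccaraBanque.infoSets →
          (k₁, k₂, j) ≠ (6, 10, 6) → (k₁, k₂, j) ≠ (10, 6, 6) →
          ((k₁, k₂, j) ∈ T.1 ↔ j ≤ BaccaraBanque.maxDrawingTotal k₁ k₂)) ∧
    BaccaraBanque.lowerValue (1 / 2) < BaccaraBanque.upperValue (1 / 2) ∧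
    ¬ BaccaraBanque.HasValue (1 / 2) := by
  obtain ⟨h₁, h₂⟩ := BaccaraBanque.sqrt_bounds
  refine ⟨BaccaraBanque.isMaximin_half_iff, ?_,
    BaccaraBanque.lowerValue_half.trans BaccaraBanque.scaledValue_div, ?_,
    BaccaraBanque.isBestResponse_drawProb_iff, BaccaraBanque.lowerValue_lt_upperValue_half,
    BaccaraBanque.lowerValue_lt_upperValue_half.ne⟩
  · rw [abs_lt]
    norm_num at h₁ h₂ ⊢
    constructor <;> linarith
  · rw [abs_lt]
    norm_num at h₁ h₂ ⊢
    constructor <;> linarith
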